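/- Let $\mathbf X=\ell^2(\mathbb Z)$ be the complex Hilbert space with a fixed orthonormal basis $(e_i)_{i\in\mathbb Z}$, and identify a bounded linear operator $A$ on $\mathbf X$ with its matrix $A_{i,j}=\langle Ae_j,e_i\rangle$. The numerical range of $A$ is the closed set \[N(A)=\operatorname{clos}\{\langle Ax,x\rangle : x\in\mathbf X,\ \|x\|=1\}.\] For $\sigma>0$ let $M$ be the set of bounded linear operators $A$ on $\mathbf X$ with $A_{i,i+1}=1$, $A_{i,i}=0$ and $A_{i+1,i}\in\{\sigma,-\sigma\}$ for all $i\in\mathbb Z$ and $A_{i,j}=0$ for $|i-j|>1$; let $M_{fin}$ be the set of finite square matrices $B$ with entries of the same form: $B_{i,i+1}=1$, $B_{i,i}=0$, $B_{i+1,i}\in\{\sigma,-\sigma\}$ and $B_{i,j}=0$ for $|i-j|>1$. An operator $A\in M$ is called pseudo-ergodic, written $A\in\Psi E(\{1\},\{0\},\{\pm\sigma\})$, if for every $\varepsilon>0$ and every $B\in M_{fin}$, of size $n\times n$ say, there is $k\in\mathbb Z$ such that $\|(A_{k+i,k+j})_{i,j=0}^{n-1}-B\|\le\varepsilon$ in the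 operator norm induced by the Euclidean norm on $\mathbb C^n$. Theorem. Let $\sigma\in(0,1]$ and let $A\in\Psi E(\{1\},\{0\},\{\pm\sigma\})$. Then \[N(A^2)\subsetneq N(A)^2:=\{z^2 : z\in N(A)\}.\] -/

import Mathlib

/-- The Hilbert space `ℓ²(ℤ)` of square-summable complex two-sided sequences. -/
abbrev EllTwoZ : Type := lp (fun _ : ℤ => ℂ) 2

/-- The (closed) numerical range: the closure of `{⟨A x, x⟩ : ‖x‖ = 1}`. Mathlib's inner product is
linear in its second argument, so `⟨A x, x⟩` (linear in the first argument) is `inner ℂ x (A x)`. -/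
def closedNumericalRange {H : Type*} [NormedAddCommGroup H] [InnerProductSpace ℂ H]
    (A : H →L[ℂ] H) : Set ℂ :=
  closure {z : ℂ | ∃ x : H, ‖x‖ = 1 ∧ z = inner ℂ x (A x)}

/-- The matrix entry `A_{i,j} = ⟨A e_j, e_i⟩` with respect to the orthonormal basis `e`. -/
noncomputable def matrixEntry (e : HilbertBasis ℤ ℂ EllTwoZ) (A : EllTwoZ →L[ℂ] EllTwoZ)
    (i j : ℤ) : ℂ :=
  inner ℂ (e i) (A (e j))

/-- `M(U_n, …, U_m)`: the bounded operators whose `k`-th diagonal `(A_{i+k,i})_i` takes values in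
`U k` for `n ≤ k ≤ m` and vanishes for all other `k`. Only the values `U k` with `n ≤ k ≤ m`
matter. -/
def bandOperators (e : HilbertBasis ℤ ℂ EllTwoZ) (n m : ℤ) (U : ℤ → Set ℂ) :
    Set (EllTwoZ →L[ℂ] EllTwoZ) :=
  {A | ∀ i k : ℤ,
    ((n ≤ k ∧ k ≤ m) → matrixEntry e A (i + k) i ∈ U k) ∧
    (¬ (n ≤ k ∧ k ≤ m) → matrixEntry e A (i + k) i = 0)}

/-- `M_fin(U_n, …, U_m)`, matrices of size `N`: the entry in row `i` and column `j` lies on the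
diagonal with index `i - j`. -/
def finiteBandMatrices (N : ℕ) (n m : ℤ) (U : ℤ → Set ℂ) : Set (Matrix (Fin N) (Fin N) ℂ) :=
  {B | ∀ i j : Fin N,
    ((n ≤ (i : ℤ) - (j : ℤ) ∧ (i : ℤ) - (j : ℤ) ≤ m) → B i j ∈ U ((i : ℤ) - (j : ℤ))) ∧
    (¬ (n ≤ (i : ℤ) - (j : ℤ) ∧ (i : ℤ) - (j : ℤ) ≤ m) → B i j = 0)}

/-- The finite section `P_{k,l} A P_{k,l}` with `l = k + N - 1`, as a matrix of size `N`: the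
compression of `A` to the span of `e_k, …, e_{k+N-1}`. -/
noncomputable def finiteSection (e : HilbertBasis ℤ ℂ EllTwoZ) (A : EllTwoZ →L[ℂ] EllTwoZ)
    (k : ℤ) (N : ℕ) : Matrix (Fin N) (Fin N) ℂ :=
  Matrix.of fun i j => matrixEntry e A (k + (i : ℤ)) (k + (j : ℤ))

/-- `ΨE(U_n, …, U_m)`: the operators in `M(U_n, …, U_m)` such that every matrix in
`M_fin(U_n, …, U_m)` is approximated, up to any `ε > 0` in the operator norm induced by the
Euclidean norm, by some finite section of the same size. -/
def pseudoErgodicOperators (e : HilbertBasis ℤ ℂ EllTwoZ) (n m : ℤ) (U : ℤ → Set ℂ) :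
    Set (EllTwoZ →L[ℂ] EllTwoZ) :=
  {A | A ∈ bandOperators e n m U ∧
    ∀ ε : ℝ, 0 < ε → ∀ N : ℕ, ∀ B ∈ finiteBandMatrices N n m U,
      ∃ k : ℤ, ‖Matrix.toEuclideanCLM (n := Fin N) (𝕜 := ℂ) (finiteSection e A k N - B)‖ ≤ ε}

/-- The family `(U_{-1}, U_0, U_1)` of sets for the three diagonals of a tridiagonal operator. -/
def tridiagonalSets (Usup Udiag Usub : Set ℂ) : ℤ → Set ℂ := fun k =>
  if k = -1 then Usup else if k = 0 then Udiag else if k = 1 then Usub else {0}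

open ComplexConjugate

/-! For unimodular `u`, `c` one has `2 Re((u² + c̄)⟨A²x, x⟩) = ‖uAx + ūA*x‖² - ‖Ax - cA*x‖²`
(`two_mul_re_mul_inner_sq`). In coordinates, each row of the right side involves only `x_{i+1}`,
`x_{i-1}` and two signs, so row bounds control `N(A²)`.

Inclusion: let `z² ∈ N(A²)`. Dropping the subtracted square and choosing `c` with `c̄z² = |z|²`
gives `Re(uz) ≤ max |u ± σū|` for every `u`. Pseudo-ergodicity puts the ellipses `ζ ± σζ̄`, `|ζ| =
1`, in `N(A)`, and they attain this bound; as `N(A)` is closed and convex, separation yields `z ∈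
N(A)`.

Strictness: for `u² = -i` the support line touches both ellipses, so `N(A)` contains the segment
between the contact points. At a suitable point of it, equality in the bound would need both the
parallelogram defect and `Ax - cA*x` to be small in every row; an invertible 2 × 2 system forbids
this uniformly. -/

/-! ### Convexity of the numerical range (Toeplitz–Hausdorff). -/

theorem convex_setOf_inner_unit {H : Type*} [NormedAddCommGroup H] [InnerProductSpace ℂ H]
    (T : H →L[ℂ] H) : Convex ℝ {z : ℂ | ∃ x : H, ‖x‖ = 1 ∧ z = inner ℂ x (T x)} := by
  rintro _ ⟨x, hx, rfl⟩ _ ⟨y, hy, rfl⟩ r s hr hs hrs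
  obtain rfl : r = 1 - s := by linarith
  by_cases hab : (inner ℂ x (T x) : ℂ) = inner ℂ y (T y)
  · refine ⟨x, hx, ?_⟩
    rw [← hab, ← add_smul, hrs, one_smul]
  set a : ℂ := inner ℂ x (T x) with ha
  set b : ℂ := inner ℂ y (T y) with hb
  have hd : b - a ≠ 0 := sub_ne_zero.2 (Ne.symm hab)
  set p : ℂ := (inner ℂ x (T y) - a * inner ℂ x y) / (b - a) with hp
  set q : ℂ := (inner ℂ y (T x) - a * inner ℂ y x) / (b - a) with hq
  have hxx : (inner ℂ x x : ℂ) = 1 := by rw [inner_self_eq_norm_sq_to_K, hx]; simp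
  have hyy : (inner ℂ y y : ℂ) = 1 := by rw [inner_self_eq_norm_sq_to_K, hy]; simp
  -- This phase makes the cross term real, so the form along `z t` stays on the line through `a` and
  -- `b`. The imaginary part is that of `μ (q - conj p)`.
  obtain ⟨μ, hμ, him⟩ : ∃ μ : ℂ, conj μ * μ = 1 ∧ (conj μ * p + μ * q).im = 0 := by
    by_cases h0 : q - conj p = 0
    · refine ⟨1, by simp, ?_⟩
      rw [sub_eq_zero.1 h0]; simp
    · have hn : ((‖q - conj p‖ : ℝ) : ℂ) ≠ 0 := by simpa using h0
      have key : conj (q - conj p) * (q - conj p) = (‖q - conj p‖ : ℂ) ^ 2 :=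
        Complex.conj_mul' _
      refine ⟨conj (q - conj p) / ‖q - conj p‖, ?_, ?_⟩
      · rw [map_div₀, Complex.conj_conj, Complex.conj_ofReal, div_mul_div_comm,
          mul_comm (q - conj p), key, ← sq, div_self (pow_ne_zero 2 hn)]
      · rw [map_div₀, Complex.conj_conj, Complex.conj_ofReal, div_mul_eq_mul_div,
          div_mul_eq_mul_div, ← add_div, Complex.div_ofReal_im]
        simp [Complex.mul_im]
        left; ring
  set ρ : ℝ := (conj μ * p + μ * q).re with hρ
  have hρ' : conj μ * p + μ * q = (ρ : ℂ) := Complex.ext (by simp [hρ]) (by simpa using him)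
  set z : ℝ → H := fun t => ((1 - t : ℝ) * μ : ℂ) • x + (t : ℂ) • y with hz
  have hμ0 : μ ≠ 0 := by rintro rfl; simp at hμ
  have hμn : ‖μ‖ = 1 := by
    have := congrArg (‖·‖) hμ
    simp only [norm_mul, Complex.norm_conj, norm_one] at this
    nlinarith [norm_nonneg μ]
  have hTz (t : ℝ) : (inner ℂ (z t) (T (z t)) : ℂ) =
      a * inner ℂ (z t) (z t) + (b - a) * ((t ^ 2 + t * (1 - t) * ρ : ℝ) : ℂ) := by
    have e1 : (inner ℂ x (T y) : ℂ) = p * (b - a) + a * inner ℂ x y := by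
      rw [hp, div_mul_cancel₀ _ hd]; ring
    have e2 : (inner ℂ y (T x) : ℂ) = q * (b - a) + a * inner ℂ y x := by
      rw [hq, div_mul_cancel₀ _ hd]; ring
    simp only [hz, map_add, map_smul, inner_add_left, inner_add_right, inner_smul_left,
      inner_smul_right, map_mul, Complex.conj_ofReal, hxx, hyy, e1, e2, ← ha, ← hb]
    push_cast
    rw [← hρ']
    ring
  have hz0 (t : ℝ) (ht : t ∈ Set.Icc (0 : ℝ) 1) : z t ≠ 0 := by
    intro h0
    have h1 : (t : ℂ) • y = -(((1 - t : ℝ) * μ : ℂ) • x) := (neg_eq_of_add_eq_zero_right h0).symm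
    have h2 := congrArg norm h1
    rw [norm_neg, norm_smul, norm_smul, hx, hy, norm_mul, hμn, Complex.norm_real,
      Complex.norm_real, Real.norm_of_nonneg ht.1, Real.norm_of_nonneg (by linarith [ht.2])] at h2
    have ht2 : t = 1 / 2 := by linarith
    have h3 : y = -(μ • x) := by
      have := congrArg (fun v => (2 : ℂ) • v) h1
      simp only [ht2, ← smul_neg, smul_smul] at this
      norm_num at this
      simpa using this
    apply hab
    rw [hb, h3]
    simp only [map_neg, map_smul, inner_neg_left, inner_neg_right, inner_smul_left,
      inner_smul_right, ← ha]
    linear_combination -a * hμ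
  have hcont : Continuous fun t : ℝ => t ^ 2 + t * (1 - t) * ρ - s * ‖z t‖ ^ 2 := by
    simp only [hz]; fun_prop
  have hz_zero : ‖z 0‖ = 1 := by simp [hz, norm_smul, hμn, hx]
  have hz_one : ‖z 1‖ = 1 := by simp [hz, hy]
  obtain ⟨t, ht, hts⟩ := intermediate_value_Icc (zero_le_one' ℝ) hcont.continuousOn
    (show (0 : ℝ) ∈ Set.Icc _ _ by
      constructor
      · simp only [hz_zero]; norm_num; exact hs
      · simp only [hz_one]; norm_num; linarith)
  have hn : (‖z t‖ : ℂ) ≠ 0 := by simpa using hz0 t ht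
  refine ⟨((‖z t‖ : ℂ)⁻¹) • z t, ?_, ?_⟩
  · rw [norm_smul, norm_inv, Complex.norm_real, norm_norm,
      inv_mul_cancel₀ (norm_ne_zero_iff.2 (hz0 t ht))]
  · have h4 : t ^ 2 + t * (1 - t) * ρ = s * ‖z t‖ ^ 2 := by linarith
    rw [map_smul, inner_smul_left, inner_smul_right, hTz, h4, inner_self_eq_norm_sq_to_K]
    simp only [Complex.coe_algebraMap, map_inv₀, Complex.conj_ofReal, Complex.real_smul]
    push_cast
    field_simp
    ring

theorem convex_closedNumericalRange {H : Type*} [NormedAddCommGroup H] [InnerProductSpace ℂ H]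
    (T : H →L[ℂ] H) : Convex ℝ (closedNumericalRange T) :=
  (convex_setOf_inner_unit T).closure

/-! ### A lower bound for invertible 2 × 2 systems, by Cramer's rule. -/

theorem exists_pos_mul_le_of_det_ne_zero {α β γ δ : ℂ} (h : α * δ - β * γ ≠ 0) :
    ∃ κ : ℝ, 0 < κ ∧ ∀ a b : ℂ, κ * (‖a‖ ^ 2 + ‖b‖ ^ 2) ≤
      ‖α * a + β * b‖ ^ 2 + ‖γ * a + δ * b‖ ^ 2 := by
  set D := α * δ - β * γ with hD
  have hDpos : 0 < ‖D‖ ^ 2 := by positivity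
  set S := ‖α‖ ^ 2 + ‖β‖ ^ 2 + ‖γ‖ ^ 2 + ‖δ‖ ^ 2 with hS
  have cs (x y s t : ℂ) : ‖x * s - y * t‖ ^ 2 ≤ 2 * (‖x‖ ^ 2 * ‖s‖ ^ 2 + ‖y‖ ^ 2 * ‖t‖ ^ 2) := by
    have := norm_sub_le (x * s) (y * t)
    rw [norm_mul, norm_mul] at this
    nlinarith [norm_nonneg (x * s - y * t), sq_nonneg (‖x‖ * ‖s‖ - ‖y‖ * ‖t‖)]
  have hSpos : 0 < 2 * S + 1 := by positivity
  refine ⟨‖D‖ ^ 2 / (2 * S + 1), by positivity, fun a b => ?_⟩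
  rw [div_mul_eq_mul_div, div_le_iff₀ hSpos]
  set s := α * a + β * b with hs
  set t := γ * a + δ * b with ht
  have ea : D * a = δ * s - β * t := by rw [hD, hs, ht]; ring
  have eb : D * b = α * t - γ * s := by rw [hD, hs, ht]; ring
  have h1 := cs δ β s t
  have h2 := cs α γ t s
  rw [← ea, norm_mul, mul_pow] at h1
  rw [← eb, norm_mul, mul_pow] at h2
  nlinarith [mul_nonneg (sq_nonneg ‖α‖) (sq_nonneg ‖s‖), mul_nonneg (sq_nonneg ‖β‖) (sq_nonneg ‖s‖),
    mul_nonneg (sq_nonneg ‖γ‖) (sq_nonneg ‖t‖), mul_nonneg (sq_nonneg ‖δ‖) (sq_nonneg ‖t‖),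
    sq_nonneg ‖s‖, sq_nonneg ‖t‖]

/-! ### The norm identity for the square and its row-wise form. -/

theorem two_mul_re_mul_inner_sq {H : Type*} [NormedAddCommGroup H] [InnerProductSpace ℂ H]
    [CompleteSpace H] (A : H →L[ℂ] H) {u c : ℂ} (hu : ‖u‖ = 1) (hc : ‖c‖ = 1) (x : H) :
    2 * ((u ^ 2 + conj c) * inner ℂ x ((A ^ 2) x)).re =
      ‖u • A x + conj u • A.adjoint x‖ ^ 2 - ‖A x - c • A.adjoint x‖ ^ 2 := by
  have hw : (inner ℂ x ((A ^ 2) x) : ℂ) = inner ℂ (A.adjoint x) (A x) := by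
    rw [ContinuousLinearMap.adjoint_inner_left, sq]; rfl
  rw [hw, add_comm (u • A x), norm_sub_rev, norm_add_sq (𝕜 := ℂ), norm_sub_sq (𝕜 := ℂ)]
  simp only [norm_smul, Complex.norm_conj, hu, hc, inner_smul_left, inner_smul_right,
    Complex.conj_conj, RCLike.re_eq_complex_re]
  rw [add_mul, Complex.add_re, sq, ← mul_assoc u u]
  ring

theorem HilbertBasis.ext_inner {ι E : Type*} [NormedAddCommGroup E] [InnerProductSpace ℂ E]
    (b : HilbertBasis ι ℂ E) {x y : E} (h : ∀ i, (inner ℂ (b i) x : ℂ) = inner ℂ (b i) y) :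
    x = y := by
  apply b.repr.injective
  ext i
  rw [b.repr_apply_apply, b.repr_apply_apply, h]

theorem HilbertBasis.hasSum_norm_inner_sq {ι E : Type*} [NormedAddCommGroup E]
    [InnerProductSpace ℂ E] (b : HilbertBasis ι ℂ E) (x : E) :
    HasSum (fun i => ‖(inner ℂ (b i) x : ℂ)‖ ^ 2) (‖x‖ ^ 2) := by
  have h := Complex.hasSum_re (b.hasSum_inner_mul_inner x x)
  rw [inner_self_eq_norm_sq_to_K] at h
  convert h using 1
  · funext i
    rw [← inner_conj_symm x (b i), Complex.conj_mul']
    norm_cast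
  · norm_cast

theorem norm_eq_one_of_inner_self_eq_one {E : Type*} [NormedAddCommGroup E]
    [InnerProductSpace ℂ E] {x : E} (h : (inner ℂ x x : ℂ) = 1) : ‖x‖ = 1 := by
  have h2 : ‖x‖ ^ 2 = 1 := by rw [← inner_self_eq_norm_sq (𝕜 := ℂ), h]; simp
  exact (pow_eq_one_iff_of_nonneg (norm_nonneg _) two_ne_zero).1 h2

theorem exists_rows_of_mem_bandOperators {e : HilbertBasis ℤ ℂ EllTwoZ} {σ : ℝ}
    {A : EllTwoZ →L[ℂ] EllTwoZ}
    (hA : A ∈ bandOperators e (-1) 1 (tridiagonalSets {1} {0} {(σ : ℂ), -(σ : ℂ)})) :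
    ∃ v : ℤ → ℝ, (∀ i, v i = σ ∨ v i = -σ) ∧
      (∀ i x, (inner ℂ (e i) (A x) : ℂ) =
        inner ℂ (e (i + 1)) x + v (i - 1) * inner ℂ (e (i - 1)) x) ∧
      ∀ i x, (inner ℂ (e i) (A.adjoint x) : ℂ) =
        inner ℂ (e (i - 1)) x + v i * inner ℂ (e (i + 1)) x := by
  have hsub (i : ℤ) : ∃ r : ℝ, (r = σ ∨ r = -σ) ∧ matrixEntry e A (i + 1) i = r := by
    have := (hA i 1).1 (by norm_num)
    simp only [tridiagonalSets] at this
    norm_num at this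
    rcases this with h | h
    · exact ⟨σ, Or.inl rfl, h⟩
    · exact ⟨-σ, Or.inr rfl, by rw [h]; push_cast; rfl⟩
  choose v hv hvA using hsub
  have hentry (i j : ℤ) : (inner ℂ (e i) (A (e j)) : ℂ) =
      (if i + 1 = j then 1 else 0) + (if i - 1 = j then (v (i - 1) : ℂ) else 0) := by
    change matrixEntry e A i j = _
    have h := hA j (i - j)
    rw [add_sub_cancel] at h
    by_cases h1 : i + 1 = j
    · have := h.1 (by omega)
      rw [if_pos h1, if_neg (by omega), add_zero]
      simpa [tridiagonalSets, show i - j = -1 by omega] using this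
    by_cases h2 : i - 1 = j
    · rw [if_neg h1, if_pos h2, zero_add, h2, ← hvA, ← h2, sub_add_cancel]
    by_cases h3 : i = j
    · have := h.1 (by omega)
      rw [if_neg h1, if_neg h2, add_zero]
      simpa [tridiagonalSets, h3] using this
    · rw [if_neg h1, if_neg h2, add_zero]
      exact h.2 (by omega)
  have hee (i j : ℤ) : (inner ℂ (e i) (e j) : ℂ) = if i = j then 1 else 0 :=
    orthonormal_iff_ite.1 e.orthonormal i j
  have hadj (i : ℤ) : A.adjoint (e i) = e (i + 1) + (v (i - 1) : ℂ) • e (i - 1) := by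
    refine e.ext_inner fun j => ?_
    rw [ContinuousLinearMap.adjoint_inner_right, ← inner_conj_symm, hentry, inner_add_right,
      inner_smul_right, hee, hee]
    simp only [eq_comm (a := j)]
    split_ifs <;> simp
  have hcol (i : ℤ) : A (e i) = e (i - 1) + (v i : ℂ) • e (i + 1) := by
    refine e.ext_inner fun j => ?_
    rw [hentry, inner_add_right, inner_smul_right, hee, hee]
    by_cases h : j - 1 = i
    · rw [if_pos h, h, if_neg (by omega), if_neg (by omega), if_pos (by omega)]; simp
    · rw [if_neg h, if_neg (show ¬ j = i + 1 by omega)]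
      simp only [show (j + 1 = i) = (j = i - 1) by apply propext; omega]; simp
  refine ⟨v, hv, fun i x => ?_, fun i x => ?_⟩
  · rw [← ContinuousLinearMap.adjoint_inner_left, hadj, inner_add_left, inner_smul_left,
      Complex.conj_ofReal]
  · rw [ContinuousLinearMap.adjoint_inner_right, hcol, inner_add_left, inner_smul_left,
      Complex.conj_ofReal]

/-- Parseval applied row by row; each coordinate of `x` enters two rows, as `a` and as `b`, whence
the factor 2. -/
theorem norm_sq_sub_norm_sq_le {e : HilbertBasis ℤ ℂ EllTwoZ} {A : EllTwoZ →L[ℂ] EllTwoZ}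
    {v : ℤ → ℝ}
    (hrow : ∀ i x, (inner ℂ (e i) (A x) : ℂ) =
      inner ℂ (e (i + 1)) x + v (i - 1) * inner ℂ (e (i - 1)) x)
    (hadj : ∀ i x, (inner ℂ (e i) (A.adjoint x) : ℂ) =
      inner ℂ (e (i - 1)) x + v i * inner ℂ (e (i + 1)) x)
    {u c : ℂ} {K : ℝ}
    (h : ∀ i (a b : ℂ), ‖(u + v i * conj u) * a + (conj u + v (i - 1) * u) * b‖ ^ 2 -
      ‖(1 - c * v i) * a + (v (i - 1) - c) * b‖ ^ 2 ≤ K * (‖a‖ ^ 2 + ‖b‖ ^ 2)) (x : EllTwoZ) :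
    ‖u • A x + conj u • A.adjoint x‖ ^ 2 - ‖A x - c • A.adjoint x‖ ^ 2 ≤ 2 * K * ‖x‖ ^ 2 := by
  have h1 := (e.hasSum_norm_inner_sq (u • A x + conj u • A.adjoint x)).sub
    (e.hasSum_norm_inner_sq (A x - c • A.adjoint x))
  have hx := e.hasSum_norm_inner_sq x
  have h2 := (((Equiv.addRight (1 : ℤ)).hasSum_iff.2 hx).add
    ((Equiv.addRight (-1 : ℤ)).hasSum_iff.2 hx)).mul_left K
  refine (hasSum_le (fun i => ?_) h1 h2).trans_eq (by ring)
  refine le_trans (le_of_eq ?_) (h i (inner ℂ (e (i + 1)) x) (inner ℂ (e (i - 1)) x))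
  rw [inner_add_right, inner_sub_right, inner_smul_right, inner_smul_right, inner_smul_right,
    hrow, hadj]
  congr 3 <;> ring_nf

theorem norm_add_mul_conj_sq {u : ℂ} (hu : ‖u‖ = 1) (r : ℝ) :
    ‖u + r * conj u‖ ^ 2 = 1 + r ^ 2 + 2 * r * (u ^ 2).re := by
  have h : u.re ^ 2 + u.im ^ 2 = 1 := by
    rw [← one_pow 2, ← hu, Complex.sq_norm, Complex.normSq_apply]; ring
  rw [Complex.sq_norm, Complex.normSq_apply]
  simp [sq]
  linear_combination (1 + r ^ 2) * h

theorem norm_conj_add_mul {u : ℂ} (r : ℝ) : ‖conj u + r * u‖ = ‖u + r * conj u‖ := by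
  rw [← Complex.norm_conj]; simp

theorem re_mul_le_of_mem_closedNumericalRange_sq {e : HilbertBasis ℤ ℂ EllTwoZ}
    {A : EllTwoZ →L[ℂ] EllTwoZ} {v : ℤ → ℝ}
    (hrow : ∀ i x, (inner ℂ (e i) (A x) : ℂ) =
      inner ℂ (e (i + 1)) x + v (i - 1) * inner ℂ (e (i - 1)) x)
    (hadj : ∀ i x, (inner ℂ (e i) (A.adjoint x) : ℂ) =
      inner ℂ (e (i - 1)) x + v i * inner ℂ (e (i + 1)) x)
    {u c : ℂ} (hu : ‖u‖ = 1) (hc : ‖c‖ = 1) {K : ℝ}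
    (h : ∀ i (a b : ℂ), ‖(u + v i * conj u) * a + (conj u + v (i - 1) * u) * b‖ ^ 2 -
      ‖(1 - c * v i) * a + (v (i - 1) - c) * b‖ ^ 2 ≤ K * (‖a‖ ^ 2 + ‖b‖ ^ 2))
    {w : ℂ} (hw : w ∈ closedNumericalRange (A ^ 2)) : ((u ^ 2 + conj c) * w).re ≤ K := by
  have hclosed : IsClosed {w : ℂ | ((u ^ 2 + conj c) * w).re ≤ K} :=
    isClosed_le (by fun_prop) continuous_const
  refine closure_minimal ?_ hclosed hw
  rintro _ ⟨x, hx, rfl⟩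
  have h1 := norm_sq_sub_norm_sq_le hrow hadj h x
  rw [← two_mul_re_mul_inner_sq A hu hc, hx] at h1
  simp only [Set.mem_ofPred_eq]
  linarith

/-! ### The two ellipses inside the numerical range. -/

theorem sum_sum_conj_mul_mul {N : ℕ} {ζ : ℂ} (hζ : ‖ζ‖ = 1) (r : ℂ) :
    ∑ a : Fin (N + 1), ∑ b : Fin (N + 1), conj (ζ ^ (a : ℕ)) *
      (if (b : ℕ) = a + 1 then 1 else if (a : ℕ) = b + 1 then r else 0) * ζ ^ (b : ℕ) =
      N * (ζ + r * conj ζ) := by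
  have hz : conj ζ * ζ = 1 := by rw [Complex.conj_mul', hζ]; simp
  have hzn (n : ℕ) : conj ζ ^ n * ζ ^ n = 1 := by rw [← mul_pow, hz, one_pow]
  have key (w : ℂ) : ∑ a : Fin (N + 1), ∑ b : Fin (N + 1),
      (if (b : ℕ) = a + 1 then w else 0) = N * w := by
    rw [Finset.sum_comm, Fin.sum_univ_succ]
    have (b : Fin N) : ∑ a : Fin (N + 1), (if ((b.succ : Fin (N + 1)) : ℕ) = a + 1 then w else 0)
        = w := by
      rw [Finset.sum_eq_single b.castSucc]
      · simp
      · intro a _ ha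
        rw [if_neg]
        intro hb
        apply ha
        ext
        simp at hb ⊢
        omega
      · simp
    simp only [this]
    simp
  rw [mul_add, ← key ζ, ← key (r * conj ζ)]
  conv_rhs => rw [add_comm, Finset.sum_comm, add_comm]
  rw [← Finset.sum_add_distrib]
  refine Finset.sum_congr rfl fun a _ => ?_
  rw [← Finset.sum_add_distrib]
  refine Finset.sum_congr rfl fun b _ => ?_
  rw [map_pow]
  by_cases h1 : (b : ℕ) = a + 1
  · rw [if_pos h1, if_pos h1, if_neg (by omega), h1]
    linear_combination ζ * hzn a
  by_cases h2 : (a : ℕ) = b + 1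
  · rw [if_neg h1, if_neg h1, if_pos h2, if_pos h2, h2]
    linear_combination r * conj ζ * hzn b
  · simp [h1, h2]

/-- Some section of `A` nearly equals the Toeplitz block with constant subdiagonal `r`. The
normalised plane wave `ζ ^ a` gives that block the value `N/(N+1) · (ζ + r ζ̄)`. -/
theorem add_mul_conj_mem_closedNumericalRange {e : HilbertBasis ℤ ℂ EllTwoZ} {σ : ℝ}
    {A : EllTwoZ →L[ℂ] EllTwoZ}
    (hA : A ∈ pseudoErgodicOperators e (-1) 1 (tridiagonalSets {1} {0} {(σ : ℂ), -(σ : ℂ)}))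
    {r : ℝ} (hr : r = σ ∨ r = -σ) {ζ : ℂ} (hζ : ‖ζ‖ = 1) :
    ζ + r * conj ζ ∈ closedNumericalRange A := by
  refine Metric.mem_closure_iff.2 fun ε hε => ?_
  obtain ⟨N, hN⟩ := exists_nat_gt (‖ζ + r * conj ζ‖ / (ε / 2))
  set B : Matrix (Fin (N + 1)) (Fin (N + 1)) ℂ := Matrix.of fun a b =>
    if (b : ℕ) = a + 1 then 1 else if (a : ℕ) = b + 1 then (r : ℂ) else 0 with hB
  have hBmem : B ∈ finiteBandMatrices (N + 1) (-1) 1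
      (tridiagonalSets {1} {0} {(σ : ℂ), -(σ : ℂ)}) := by
    intro i j
    by_cases h1 : (j : ℕ) = i + 1
    · have h2 : (i : ℤ) - j = -1 := by omega
      simp [hB, h1, tridiagonalSets]
    by_cases h2 : (i : ℕ) = j + 1
    · have h3 : (i : ℤ) - j = 1 := by omega
      have h4 : ¬ (j : ℕ) = j + 1 + 1 := by omega
      rcases hr with rfl | rfl <;> simp [hB, h2, h4, tridiagonalSets]
    · have h3 : (i : ℤ) - j ≠ -1 := by omega
      have h4 : (i : ℤ) - j ≠ 1 := by omega
      simp only [hB, Matrix.of_apply, h1, h2, if_false, tridiagonalSets, h3, h4]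
      by_cases h5 : (i : ℤ) - j = 0 <;> simp [h5]
  obtain ⟨k, hk⟩ := hA.2 (ε / 2) (by positivity) (N + 1) B hBmem
  have hn : (0 : ℝ) < ((N : ℝ) + 1) := by positivity
  set s : ℝ := (Real.sqrt (N + 1))⁻¹ with hs
  have hss : s * s = ((N : ℝ) + 1)⁻¹ := by
    rw [hs, ← mul_inv, Real.mul_self_sqrt hn.le]
  set y : Fin (N + 1) → ℂ := fun a => s * ζ ^ (a : ℕ) with hy
  have hquad (M : Matrix (Fin (N + 1)) (Fin (N + 1)) ℂ) :
      (inner ℂ (WithLp.toLp 2 y) (Matrix.toEuclideanCLM (n := Fin (N + 1)) (𝕜 := ℂ) M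
        (WithLp.toLp 2 y)) : ℂ) = ∑ a, ∑ b, conj (y a) * M a b * y b := by
    rw [PiLp.inner_apply]
    refine Finset.sum_congr rfl fun a _ => ?_
    simp [Matrix.mulVec, dotProduct, Finset.mul_sum, mul_comm, mul_left_comm, mul_assoc]
  have hynorm (a : Fin (N + 1)) : conj (y a) * y a = ((N : ℂ) + 1)⁻¹ := by
    rw [Complex.conj_mul', hy]
    simp only [norm_mul, norm_pow, hζ, one_pow, mul_one, Complex.norm_real, Real.norm_eq_abs]
    rw [← Complex.ofReal_pow, sq_abs, sq, hss]; push_cast; rfl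
  have hynorm1 : ‖WithLp.toLp 2 y‖ = 1 := by
    have : (inner ℂ (WithLp.toLp 2 y) (WithLp.toLp 2 y) : ℂ) = 1 := by
      rw [PiLp.inner_apply]
      simp only [RCLike.inner_apply', hynorm]
      simp
      exact mul_inv_cancel₀ (by exact_mod_cast hn.ne')
    exact norm_eq_one_of_inner_self_eq_one this
  set x : EllTwoZ := ∑ a : Fin (N + 1), y a • e (k + (a : ℤ)) with hx
  have hort : Orthonormal ℂ fun a : Fin (N + 1) => e (k + ((a : ℕ) : ℤ)) :=
    e.orthonormal.comp _ fun a b hab => by ext; simpa using hab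
  have hxnorm : ‖x‖ = 1 := by
    have : (inner ℂ x x : ℂ) = 1 := by
      rw [hx, hort.inner_sum]
      simp only [hynorm]
      simp
      exact mul_inv_cancel₀ (by exact_mod_cast hn.ne')
    exact norm_eq_one_of_inner_self_eq_one this
  have hxA : (inner ℂ x (A x) : ℂ) = inner ℂ (WithLp.toLp 2 y)
      (Matrix.toEuclideanCLM (n := Fin (N + 1)) (𝕜 := ℂ) (finiteSection e A k (N + 1))
        (WithLp.toLp 2 y)) := by
    rw [hquad, hx, map_sum, sum_inner]
    refine Finset.sum_congr rfl fun a _ => ?_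
    rw [inner_sum]
    refine Finset.sum_congr rfl fun b _ => ?_
    rw [map_smul, inner_smul_left, inner_smul_right]
    simp only [finiteSection, matrixEntry, Matrix.of_apply]
    ring
  have hyB : (inner ℂ (WithLp.toLp 2 y) (Matrix.toEuclideanCLM (n := Fin (N + 1)) (𝕜 := ℂ) B
      (WithLp.toLp 2 y)) : ℂ) = (ζ + r * conj ζ) - ((N : ℂ) + 1)⁻¹ * (ζ + r * conj ζ) := by
    have h1 := sum_sum_conj_mul_mul (N := N) hζ r
    have hss' : (s : ℂ) * s = ((N : ℂ) + 1)⁻¹ := by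
      rw [← Complex.ofReal_mul, hss]; push_cast; rfl
    have hn' : (N : ℂ) + 1 ≠ 0 := by exact_mod_cast hn.ne'
    rw [hquad]
    calc _ = ((s : ℂ) * s) * (N * (ζ + r * conj ζ)) := by
          rw [← h1, Finset.mul_sum]
          refine Finset.sum_congr rfl fun a _ => ?_
          rw [Finset.mul_sum]
          refine Finset.sum_congr rfl fun b _ => ?_
          simp only [hy, hB, Matrix.of_apply, map_mul, Complex.conj_ofReal]
          ring
      _ = _ := by rw [hss']; field_simp; ring
  refine ⟨inner ℂ x (A x), ⟨x, hxnorm, rfl⟩, ?_⟩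
  have hdiff : ‖(inner ℂ x (A x) : ℂ) - ((ζ + r * conj ζ) - ((N : ℂ) + 1)⁻¹ * (ζ + r * conj ζ))‖
      ≤ ε / 2 := by
    rw [hxA, ← hyB, ← inner_sub_right, ← sub_apply, ← map_sub]
    refine (norm_inner_le_norm _ _).trans ?_
    rw [hynorm1, one_mul]
    refine (ContinuousLinearMap.le_opNorm _ _).trans ?_
    rw [hynorm1, mul_one]
    exact hk
  have hsmall : ‖((N : ℂ) + 1)⁻¹ * (ζ + r * conj ζ)‖ < ε / 2 := by
    have e1 : ‖(N : ℂ) + 1‖ = (N : ℝ) + 1 := by exact_mod_cast Complex.norm_natCast (N + 1)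
    rw [norm_mul, norm_inv, e1, inv_mul_lt_iff₀ hn]
    rw [div_lt_iff₀ (by positivity)] at hN
    nlinarith
  rw [dist_eq_norm, norm_sub_rev]
  calc _ = ‖((inner ℂ x (A x) : ℂ) - ((ζ + r * conj ζ) - ((N : ℂ) + 1)⁻¹ * (ζ + r * conj ζ))) -
        ((N : ℂ) + 1)⁻¹ * (ζ + r * conj ζ)‖ := by congr 1; ring
    _ ≤ _ := norm_sub_le _ _
    _ < ε := by linarith

/-! ### The inclusion. -/

theorem closedNumericalRange_sq_subset {e : HilbertBasis ℤ ℂ EllTwoZ} {σ : ℝ} (hσ : 0 < σ)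
    {A : EllTwoZ →L[ℂ] EllTwoZ}
    (hA : A ∈ pseudoErgodicOperators e (-1) 1 (tridiagonalSets {1} {0} {(σ : ℂ), -(σ : ℂ)})) :
    closedNumericalRange (A ^ 2) ⊆ (fun z : ℂ => z ^ 2) '' closedNumericalRange A := by
  intro w hw
  obtain ⟨v, hv, hrow, hadj⟩ := exists_rows_of_mem_bandOperators hA.1
  obtain ⟨z, hz⟩ := IsAlgClosed.exists_pow_nat_eq w two_pos
  refine ⟨z, ?_, hz⟩
  by_contra hzA
  obtain ⟨f, s, hfs, hsz⟩ := RCLike.geometric_hahn_banach_closed_point (𝕜 := ℂ)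
    (convex_closedNumericalRange A) isClosed_closure hzA
  set g := f 1 with hg
  have hf (y : ℂ) : f y = g * y := by
    rw [hg, mul_comm, ← smul_eq_mul, ← map_smul, smul_eq_mul, mul_one]
  have hmem (r : ℝ) (hr : r = σ ∨ r = -σ) (ζ : ℂ) (hζ : ‖ζ‖ = 1) :=
    add_mul_conj_mem_closedNumericalRange hA hr hζ
  have hg0 : g ≠ 0 := by
    intro h0
    have h1 := hfs _ (hmem σ (Or.inl rfl) 1 norm_one)
    rw [hf, h0] at h1 hsz
    simp only [zero_mul] at h1 hsz
    linarith
  have hgn : (‖g‖ : ℂ) ≠ 0 := by simpa using hg0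
  set u := g / ‖g‖ with hu
  have hgu : g = ‖g‖ * u := by rw [hu, mul_div_cancel₀ _ hgn]
  have hun : ‖u‖ = 1 := by
    rw [hu, norm_div, Complex.norm_real, norm_norm, div_self (norm_ne_zero_iff.2 hg0)]
  obtain ⟨r, hr, hrmax⟩ : ∃ r : ℝ, (r = σ ∨ r = -σ) ∧ 2 * r * (u ^ 2).re = 2 * σ * |(u ^ 2).re| := by
    rcases le_total 0 (u ^ 2).re with h | h
    · exact ⟨σ, Or.inl rfl, by rw [abs_of_nonneg h]⟩
    · exact ⟨-σ, Or.inr rfl, by rw [abs_of_nonpos h]; ring⟩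
  set q := u + r * conj u with hq
  have hsq (t : ℝ) (ht : t = σ ∨ t = -σ) : t ^ 2 = σ ^ 2 := by rcases ht with rfl | rfl <;> ring
  have hqsq : ‖q‖ ^ 2 = 1 + σ ^ 2 + 2 * σ * |(u ^ 2).re| := by
    rw [hq, norm_add_mul_conj_sq hun, hrmax, hsq r hr]
  have hle (t : ℝ) (ht : t = σ ∨ t = -σ) : ‖u + t * conj u‖ ^ 2 ≤ ‖q‖ ^ 2 := by
    rw [hqsq, norm_add_mul_conj_sq hun, hsq t ht]
    have := neg_abs_le (u ^ 2).re
    have := le_abs_self (u ^ 2).re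
    rcases ht with rfl | rfl <;> nlinarith
  have hq0 : 0 < ‖q‖ := by
    have : 0 < ‖q‖ ^ 2 := by rw [hqsq]; positivity
    exact norm_pos_iff.2 fun h0 => by simp [h0] at this
  have hbound : (u * z).re ≤ ‖q‖ := by
    obtain ⟨c, hc, hcw⟩ : ∃ c : ℂ, ‖c‖ = 1 ∧ (conj c * w).re = ‖w‖ := by
      by_cases h0 : w = 0
      · exact ⟨1, norm_one, by simp [h0]⟩
      · have hw0 : (‖w‖ : ℂ) ≠ 0 := by simpa using h0
        refine ⟨w / ‖w‖, ?_, ?_⟩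
        · rw [norm_div, Complex.norm_real, norm_norm, div_self (norm_ne_zero_iff.2 h0)]
        · rw [map_div₀, Complex.conj_ofReal, div_mul_eq_mul_div, Complex.conj_mul', sq,
            mul_div_assoc, div_self hw0, mul_one, Complex.ofReal_re]
    have h1 := re_mul_le_of_mem_closedNumericalRange_sq hrow hadj hun hc (K := 2 * ‖q‖ ^ 2)
      (fun i a b => by
        have h2 := norm_add_le ((u + v i * conj u) * a) ((conj u + v (i - 1) * u) * b)
        rw [norm_mul, norm_mul, norm_conj_add_mul] at h2
        have h3 := mul_le_mul_of_nonneg_right (hle _ (hv i)) (sq_nonneg ‖a‖)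
        have h4 := mul_le_mul_of_nonneg_right (hle _ (hv (i - 1))) (sq_nonneg ‖b‖)
        have h5 := pow_le_pow_left₀ (norm_nonneg _) h2 2
        nlinarith [sq_nonneg (‖(1 - c * v i) * a + (v (i - 1) - c) * b‖),
          sq_nonneg (‖u + v i * conj u‖ * ‖a‖ - ‖u + v (i - 1) * conj u‖ * ‖b‖)]) hw
    rw [add_mul, Complex.add_re, hcw, ← hz, norm_pow, ← mul_pow] at h1
    have h2 : ‖z‖ ^ 2 = (u * z).re ^ 2 + (u * z).im ^ 2 := by
      rw [← one_mul ‖z‖, ← hun, ← norm_mul, Complex.sq_norm, Complex.normSq_apply]; ring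
    have h3 : ((u * z) ^ 2).re = (u * z).re ^ 2 - (u * z).im ^ 2 := by
      rw [sq, Complex.mul_re]; ring
    -- Here `Re((uz)²) + |uz|² = 2 (Re(uz))²`.
    exact abs_le_of_sq_le_sq' (by linarith) hq0.le |>.2
  have hqn : (‖q‖ : ℂ) ≠ 0 := by exact_mod_cast hq0.ne'
  have hζn : ‖conj q / ‖q‖‖ = 1 := by
    rw [norm_div, Complex.norm_conj, Complex.norm_real, norm_norm, div_self hq0.ne']
  have h6 := hfs _ (hmem r hr _ hζn)
  -- The ellipse point with `ζ = q̄/|q|` attains the bound, contradicting the separation.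
  have h7 : (u * (conj q / ‖q‖ + r * conj (conj q / ‖q‖))).re = ‖q‖ := by
    have h8 : (u * (r * conj (conj q / ‖q‖))).re = (conj u * r * (conj q / ‖q‖)).re := by
      rw [← Complex.conj_re]
      simp only [map_mul, Complex.conj_conj, Complex.conj_ofReal]
      rw [mul_assoc]
    rw [mul_add, Complex.add_re, h8, ← Complex.add_re, ← add_mul, mul_comm (conj u), ← hq,
      mul_div_assoc', Complex.mul_conj', sq, mul_div_assoc, div_self hqn, mul_one,
      Complex.ofReal_re]
  rw [hf, hgu, mul_assoc] at h6 hsz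
  rw [RCLike.re_eq_complex_re, Complex.re_ofReal_mul] at h6 hsz
  rw [h7] at h6
  have := mul_le_mul_of_nonneg_left hbound (norm_nonneg g)
  linarith

/-! ### Strictness. -/

theorem det_ne_zero_of_sq_eq {σ r r' : ℝ} (hσ : 0 < σ) (hr : r = σ ∨ r = -σ)
    (hr' : r' = σ ∨ r' = -σ) {u c : ℂ} (hu : ‖u‖ = 1) (hu2 : u ^ 2 = -Complex.I)
    (hc : c * (1 + (σ : ℂ) ^ 2 - σ * Complex.I) = Complex.I * (1 + (σ : ℂ) ^ 2 + σ * Complex.I)) :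
    (u + r * conj u) * (r' - c) - (-(conj u + r' * u)) * (1 - c * r) ≠ 0 := by
  intro h0
  have huu : u * conj u = 1 := by rw [Complex.mul_conj', hu]; simp
  have hI := Complex.I_sq
  have h1 : (r - Complex.I) * (r' - c) + (1 - Complex.I * r') * (1 - c * r) = 0 := by
    linear_combination u * h0 - (r * (r' - c) + (1 - c * r)) * huu -
      ((r' - c) + r' * (1 - c * r)) * hu2
  have h2 : (r - Complex.I) * (r' * (1 + (σ : ℂ) ^ 2 - σ * Complex.I) -
      Complex.I * (1 + (σ : ℂ) ^ 2 + σ * Complex.I)) + (1 - Complex.I * r') *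
      ((1 + (σ : ℂ) ^ 2 - σ * Complex.I) -
        Complex.I * (1 + (σ : ℂ) ^ 2 + σ * Complex.I) * r) = 0 := by
    linear_combination (1 + (σ : ℂ) ^ 2 - σ * Complex.I) * h1 +
      ((r - Complex.I) + (1 - Complex.I * r') * r) * hc
  have h3 := congrArg Complex.re h2
  have h4 := congrArg Complex.im h2
  rcases hr with rfl | rfl <;> rcases hr' with rfl | rfl <;>
    simp [sq] at h3 h4 <;> nlinarith [mul_pos hσ hσ, mul_pos (mul_pos hσ hσ) hσ]

theorem exists_pos_forall_of_det_ne_zero {σ : ℝ} (hσ : 0 < σ) {u c : ℂ} (hu : ‖u‖ = 1)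
    (hu2 : u ^ 2 = -Complex.I)
    (hc : c * (1 + (σ : ℂ) ^ 2 - σ * Complex.I) = Complex.I * (1 + (σ : ℂ) ^ 2 + σ * Complex.I)) :
    ∃ κ : ℝ, 0 < κ ∧ ∀ r r' : ℝ, (r = σ ∨ r = -σ) → (r' = σ ∨ r' = -σ) → ∀ a b : ℂ,
      κ * (‖a‖ ^ 2 + ‖b‖ ^ 2) ≤ ‖(u + r * conj u) * a - (conj u + r' * u) * b‖ ^ 2 +
        ‖(1 - c * r) * a + (r' - c) * b‖ ^ 2 := by
  have h (r r' : ℝ) (hr : r = σ ∨ r = -σ) (hr' : r' = σ ∨ r' = -σ) :=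
    exists_pos_mul_le_of_det_ne_zero (det_ne_zero_of_sq_eq hσ hr hr' hu hu2 hc)
  obtain ⟨k₁, p₁, h₁⟩ := h σ σ (Or.inl rfl) (Or.inl rfl)
  obtain ⟨k₂, p₂, h₂⟩ := h σ (-σ) (Or.inl rfl) (Or.inr rfl)
  obtain ⟨k₃, p₃, h₃⟩ := h (-σ) σ (Or.inr rfl) (Or.inl rfl)
  obtain ⟨k₄, p₄, h₄⟩ := h (-σ) (-σ) (Or.inr rfl) (Or.inr rfl)
  refine ⟨min (min k₁ k₂) (min k₃ k₄), by positivity, fun r r' hr hr' a b => ?_⟩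
  have hab : 0 ≤ ‖a‖ ^ 2 + ‖b‖ ^ 2 := by positivity
  rw [sub_eq_add_neg, ← neg_mul]
  rcases hr with rfl | rfl <;> rcases hr' with rfl | rfl
  · exact (mul_le_mul_of_nonneg_right (by simp) hab).trans (h₁ a b)
  · exact (mul_le_mul_of_nonneg_right (by simp) hab).trans (h₂ a b)
  · exact (mul_le_mul_of_nonneg_right (by simp) hab).trans (h₃ a b)
  · exact (mul_le_mul_of_nonneg_right (by simp) hab).trans (h₄ a b)

theorem exists_mem_closedNumericalRange_sq_notMem {e : HilbertBasis ℤ ℂ EllTwoZ} {σ : ℝ}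
    (hσ : 0 < σ) {A : EllTwoZ →L[ℂ] EllTwoZ}
    (hA : A ∈ pseudoErgodicOperators e (-1) 1 (tridiagonalSets {1} {0} {(σ : ℂ), -(σ : ℂ)})) :
    ∃ z ∈ closedNumericalRange A, z ^ 2 ∉ closedNumericalRange (A ^ 2) := by
  obtain ⟨v, hv, hrow, hadj⟩ := exists_rows_of_mem_bandOperators hA.1
  obtain ⟨u, hu2⟩ := IsAlgClosed.exists_pow_nat_eq (-Complex.I) two_pos
  have hu : ‖u‖ = 1 := by
    have : ‖u‖ ^ 2 = 1 := by rw [← norm_pow, hu2]; simp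
    exact (pow_eq_one_iff_of_nonneg (norm_nonneg _) two_ne_zero).1 this
  have huu : u * conj u = 1 := by rw [Complex.mul_conj', hu]; simp
  have hI := Complex.I_sq
  have hcu2 : conj u ^ 2 = Complex.I := by rw [← map_pow, hu2]; simp
  have hsq (t : ℝ) (ht : t = σ ∨ t = -σ) : t ^ 2 = σ ^ 2 := by rcases ht with rfl | rfl <;> ring
  have hqsq (t : ℝ) (ht : t = σ ∨ t = -σ) : ‖u + t * conj u‖ ^ 2 = 1 + σ ^ 2 := by
    rw [norm_add_mul_conj_sq hu, hu2, hsq t ht]; simp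
  set H : ℝ := 1 + σ ^ 2 with hH
  have hHpos : 0 < H := by positivity
  set h : ℝ := Real.sqrt H with hh
  have hhpos : 0 < h := Real.sqrt_pos.2 hHpos
  have hhsq : h ^ 2 = H := Real.sq_sqrt hHpos.le
  have hqn (t : ℝ) (ht : t = σ ∨ t = -σ) : ‖u + t * conj u‖ = h := by
    rw [hh, ← hqsq t ht, Real.sqrt_sq (norm_nonneg _)]
  have hh0 : (h : ℂ) ≠ 0 := by exact_mod_cast hhpos.ne'
  have hHC : (H : ℂ) = 1 + (σ : ℂ) ^ 2 := by rw [hH]; push_cast; rfl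
  have hpt (t : ℝ) (ht : t = σ ∨ t = -σ) :
      conj u * (H - 2 * t * Complex.I) / h ∈ closedNumericalRange A := by
    have h1 := add_mul_conj_mem_closedNumericalRange hA ht
      (ζ := conj (u + t * conj u) / h) (by
        rw [norm_div, Complex.norm_conj, hqn t ht, Complex.norm_real,
          Real.norm_of_nonneg hhpos.le, div_self hhpos.ne'])
    convert h1 using 1
    have ht2 : (t : ℂ) ^ 2 = (σ : ℂ) ^ 2 := by exact_mod_cast congrArg Complex.ofReal (hsq t ht)
    have hucu : u = -Complex.I * conj u := by linear_combination conj u * hu2 - u * huu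
    rw [hHC]
    simp only [map_div₀, map_add, map_mul, Complex.conj_conj, Complex.conj_ofReal]
    field_simp
    linear_combination (-2 * t) * hucu - conj u * ht2
  -- The contact points correspond to `H ∓ 2σi`. The determinant vanishes at an endpoint for equal
  -- signs and at the midpoint for opposite signs, so a quarter point is used.
  set m : ℂ := H + σ * Complex.I with hm
  have hm0 : m ≠ 0 := by
    intro h0
    have := congrArg Complex.re h0
    simp [hm] at this
    exact hHpos.ne' this
  have hcm0 : conj m ≠ 0 := by simpa using hm0
  -- Chosen so that `c̄z² = |z|²` for `z = ū m / h`.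
  set c : ℂ := Complex.I * m / conj m with hc
  have hcn : ‖c‖ = 1 := by
    rw [hc, norm_div, norm_mul, Complex.norm_I, Complex.norm_conj, one_mul,
      div_self (norm_ne_zero_iff.2 hm0)]
  have hcm : conj m = 1 + (σ : ℂ) ^ 2 - σ * Complex.I := by
    rw [hm, ← hHC]; simp [sub_eq_add_neg]
  obtain ⟨κ, hκ, hκle⟩ := exists_pos_forall_of_det_ne_zero hσ hu hu2 (c := c) (by
    rw [← hcm, ← hHC, ← hm, hc, div_mul_cancel₀ _ hcm0])
  refine ⟨conj u * m / h, ?_, fun hmem => ?_⟩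
  · have := convex_closedNumericalRange A (hpt σ (Or.inl rfl)) (hpt (-σ) (Or.inr rfl))
      (show (0 : ℝ) ≤ 1 / 4 by norm_num) (show (0 : ℝ) ≤ 3 / 4 by norm_num) (by norm_num)
    convert this using 1
    simp only [Complex.real_smul, hm]
    push_cast
    field_simp
    ring
  -- Both coefficients of the first row term have modulus `h`, so the parallelogram law gives `2H`
  -- minus the defect; the defect and the second row term together supply `κ`.
  · have h1 := re_mul_le_of_mem_closedNumericalRange_sq hrow hadj hu hcn (K := 2 * H - κ)
      (fun i a b => by
        have h2 := hκle _ _ (hv i) (hv (i - 1)) a b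
        have h3 := parallelogram_law_with_norm ℝ ((u + v i * conj u) * a)
          ((conj u + v (i - 1) * u) * b)
        rw [norm_mul, norm_mul, norm_conj_add_mul, hqn _ (hv i), hqn _ (hv (i - 1))] at h3
        nlinarith) hmem
    have hhC : (h : ℂ) ^ 2 = H := by exact_mod_cast congrArg Complex.ofReal hhsq
    have hHC0 : (H : ℂ) ≠ 0 := by exact_mod_cast hHpos.ne'
    -- The real part is exactly `2H`, above the bound `2H - κ`.
    have h2 : (u ^ 2 + conj c) * (conj u * m / h) ^ 2 = ((2 * H : ℝ) : ℂ) +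
        ((2 * σ : ℝ) : ℂ) * Complex.I := by
      have hcc : (u ^ 2 + conj c) * m = -2 * Complex.I * H := by
        rw [hu2, hc]
        simp only [map_div₀, map_mul, Complex.conj_I, Complex.conj_conj]
        rw [add_mul, div_mul_cancel₀ _ hm0, hm]
        simp
        ring
      calc _ = ((u ^ 2 + conj c) * m) * conj u ^ 2 * m / h ^ 2 := by ring
        _ = _ := by
          rw [hcc, hcu2, hhC, hm]
          push_cast
          field_simp
          linear_combination (-(H + σ * Complex.I)) * hI
    rw [h2, Complex.add_re, Complex.re_ofReal_mul, Complex.ofReal_re, Complex.I_re] at h1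
    linarith

theorem mainTheorem7 (e : HilbertBasis ℤ ℂ EllTwoZ) (σ : ℝ) (hσ : σ ∈ Set.Ioc (0 : ℝ) 1)
    (A : EllTwoZ →L[ℂ] EllTwoZ)
    (hA : A ∈ pseudoErgodicOperators e (-1) 1
      (tridiagonalSets {1} {0} {(σ : ℂ), -(σ : ℂ)})) :
    closedNumericalRange (A ^ 2) ⊂ (fun z : ℂ => z ^ 2) '' closedNumericalRange A := by
  refine ⟨closedNumericalRange_sq_subset hσ.1 hA, fun hsub => ?_⟩
  obtain ⟨z, hz, hz2⟩ := exists_mem_closedNumericalRange_sq_notMem hσ.1 hA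
  exact hz2 (hsub ⟨z, hz, rfl⟩)
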